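/- Let $\sigma:\mathbb{R}\to\mathbb{R}$ be either continuous and strictly monotonic (increasing or decreasing) or the ReLU function $t\mapsto\max\{t,0\}$. Let $d_{in}\ge 0$ and $d_{out}\ge 1$ be integers and let $a<b$ be real numbers. A network function with activation function $\sigma$ is a function $F:\mathbb{R}^{d_{in}}\to\mathbb{R}^{d_{out}}$ of the form $$F(x)=W_L\,(A_{L-1}\circ\dots\circ A_1)(x)+b_L,\qquad A_j(x)=\sigma(W_jx+b_j),$$ with depth $L\ge 1$, weights $W_j\in\mathbb{R}^{d_j\times d_{j-1}}$ and biases $b_j\in\mathbb{R}^{d_j}$, where $d_0=d_{in}$, $d_L=d_{out}$ and $\sigma$ is applied elementwise. Its width is $\omega_F=\max\{d_j: j=1,\dots,L\}$. Let $\omega_{\min}(\sigma,d_{in},d_{out})\in\mathbb{N}\cup\{\infty\}$ be the smallest $\omega$ such that for every continuous $f:[a,b]^{d_{in}}\to\mathbb{R}^{d_{out}}$ and every $\varepsilon>0$ there is a network function $F$ with activation function $\sigma$ and of width $\omega_F\le\omega$ such that $\sup_{x\in[a,b]^{d_{in}}}\lVert f(x)-F(x)\rVert<\varepsilon$, where $\lVert\cdot\rVert$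 is the Euclidean norm; set $\omega_{\min}(\sigma,d_{in},d_{out})=\infty$ if there is no such $\omega$. Then $$d_{in}<\omega_{\min}(\sigma,d_{in},d_{out}).$$ -/

import Mathlib

open scoped ENNReal Matrix

/-- A feedforward network with input dimension `m` and output dimension `n`: finitely many (possibly
zero) hidden layers, each with a weight matrix and a bias, followed by an affine output layer.
The data are weights and biases only; the activation function enters in `NeuralNet.eval`. -/
inductive NeuralNet : ℕ → ℕ → Type
  | output {m n : ℕ} (W : Matrix (Fin n) (Fin m) ℝ) (b : Fin n → ℝ) : NeuralNet m n
  | hidden {m k n : ℕ} (W : Matrix (Fin k) (Fin m) ℝ) (b : Fin k → ℝ) (N : NeuralNet k n) :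
      NeuralNet m n

namespace NeuralNet

/-- The affine map `x ↦ W x + b` between Euclidean spaces. -/
noncomputable def affine {m n : ℕ} (W : Matrix (Fin n) (Fin m) ℝ) (b : Fin n → ℝ)
    (x : EuclideanSpace ℝ (Fin m)) : EuclideanSpace ℝ (Fin n) :=
  WithLp.toLp 2 (W *ᵥ x.ofLp + b)

/-- The scalar function `σ` applied to every coordinate. -/
def applyCoord (σ : ℝ → ℝ) {n : ℕ} (x : EuclideanSpace ℝ (Fin n)) : EuclideanSpace ℝ (Fin n) :=
  WithLp.toLp 2 (fun i => σ (x i))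

/-- The network function `x ↦ W_L (A_{L-1} ∘ ⋯ ∘ A_1) x + b_L` with `A_j x = σ (W_j x + b_j)`. -/
noncomputable def eval (σ : ℝ → ℝ) :
    {m n : ℕ} → NeuralNet m n → EuclideanSpace ℝ (Fin m) → EuclideanSpace ℝ (Fin n)
  | _, _, output W b, x => affine W b x
  | _, _, hidden W b N, x => eval σ N (applyCoord σ (affine W b x))

/-- The width `max {d_1, …, d_L}`: the largest dimension of a layer, the output layer included and
the input not. -/
def width : {m n : ℕ} → NeuralNet m n → ℕ
  | _, n, output _ _ => n
  | _, _, @hidden _ k _ _ _ N => max k (width N)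

end NeuralNet

/-- The rectified linear unit. -/
noncomputable def relu (t : ℝ) : ℝ := max t 0

/-- The cube `[a, b]^d`. -/
def cube (a b : ℝ) (d : ℕ) : Set (EuclideanSpace ℝ (Fin d)) :=
  {x | ∀ i, x i ∈ Set.Icc a b}

/-- The supremum over `D` of the Euclidean norm of `g`, in `[0, ∞]`. -/
noncomputable def supNormOn {m n : ℕ} (D : Set (EuclideanSpace ℝ (Fin m)))
    (g : EuclideanSpace ℝ (Fin m) → EuclideanSpace ℝ (Fin n)) : ℝ≥0∞ :=
  ⨆ x ∈ D, ‖g x‖ₑ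

/-- Networks with activation `σ` and width at most `w` approximate every continuous function
`[a, b]^dIn → ℝ^dOut` uniformly and with arbitrary accuracy. -/
def IsUniversalWidth (σ : ℝ → ℝ) (a b : ℝ) (dIn dOut w : ℕ) : Prop :=
  ∀ f : EuclideanSpace ℝ (Fin dIn) → EuclideanSpace ℝ (Fin dOut),
    ContinuousOn f (cube a b dIn) → ∀ ε : ℝ, 0 < ε →
      ∃ N : NeuralNet dIn dOut, N.width ≤ w ∧
        supNormOn (cube a b dIn) (fun x => f x - N.eval σ x) < ENNReal.ofReal ε

/-- The minimal width for universal approximation on `[a, b]^dIn`; it is `⊤` if no width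
suffices. -/
noncomputable def minWidth (σ : ℝ → ℝ) (a b : ℝ) (dIn dOut : ℕ) : ℕ∞ :=
  sInf {v : ℕ∞ | ∃ w : ℕ, v = w ∧ IsUniversalWidth σ a b dIn dOut w}

/-!
The distance to the centre of the cube has a strict interior minimum, and a network of width at
most `dIn` cannot imitate this: its coordinate functions obey a minimum principle, each value taken
in a bounded open set `U` being bounded below by a value on the frontier of `U`. For an injective
continuous activation, which is an open map, this follows layer by layer. A hidden layer whose
matrix is not injective is constant along lines, and lines leave `U`. A hidden layer whose matrix is
injective has `dIn` neurons, so it is a continuous open map and the principle pulls back along it.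
A monotone continuous activation `σ` such as ReLU is the limit of the injective activations
`t ↦ σ t + δ t`, and the principle survives this limit because the frontier of `U` is compact.
-/

open Set Topology Filter Function

section MinPrinciple

/-- The minimum principle for a function `g`: each value of `g` on a relatively compact open set is
bounded below by a value of `g` on the frontier. It rules out strict interior minima, and no
continuity of `g` is built in. -/
def SatisfiesMinPrinciple {X α : Type*} [TopologicalSpace X] [LE α] (g : X → α) : Prop :=
  ∀ ⦃U : Set X⦄, IsOpen U → IsCompact (closure U) → ∀ p ∈ U, ∃ q ∈ frontier U, g q ≤ g p

theorem frontier_image_subset_image_frontier {X Y : Type*} [TopologicalSpace X]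
    [TopologicalSpace Y] [T2Space Y] {f : X → Y} (hf : Continuous f) (hfo : IsOpenMap f)
    {U : Set X} (hU : IsOpen U) (hUc : IsCompact (closure U)) :
    frontier (f '' U) ⊆ f '' frontier U := by
  rw [(hfo U hU).frontier_eq, hU.frontier_eq, ← image_closure_of_isCompact hUc hf.continuousOn]
  rintro _ ⟨⟨x, hx, rfl⟩, hfx⟩
  exact ⟨x, ⟨hx, fun hxU => hfx (mem_image_of_mem f hxU)⟩, rfl⟩

theorem SatisfiesMinPrinciple.comp {X Y α : Type*} [TopologicalSpace X] [TopologicalSpace Y]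
    [T2Space Y] [LE α] {g : Y → α} (hg : SatisfiesMinPrinciple g) {f : X → Y} (hf : Continuous f)
    (hfo : IsOpenMap f) : SatisfiesMinPrinciple (g ∘ f) := by
  intro U hU hUc p hp
  have hfUc : IsCompact (closure (f '' U)) :=
    image_closure_of_isCompact hUc hf.continuousOn ▸ hUc.image hf
  obtain ⟨_, hfq, hle⟩ := hg (hfo U hU) hfUc (f p) (mem_image_of_mem f hp)
  obtain ⟨q, hq, rfl⟩ := frontier_image_subset_image_frontier hf hfo hU hUc hfq
  exact ⟨q, hq, hle⟩

theorem SatisfiesMinPrinciple.of_frequently {T X α : Type*} [TopologicalSpace T]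
    [TopologicalSpace X] [LinearOrder α] [TopologicalSpace α] [OrderClosedTopology α]
    {G : T → X → α} (hG : Continuous (uncurry G)) {t₀ : T}
    (h : ∃ᶠ t in 𝓝 t₀, SatisfiesMinPrinciple (G t)) : SatisfiesMinPrinciple (G t₀) := by
  intro U hU hUc p hp
  by_contra! hlt
  have hK : IsCompact (frontier U) :=
    hUc.of_isClosed_subset isClosed_frontier frontier_subset_closure
  have hGp : Continuous fun z : T × X => G z.1 p :=
    hG.comp (continuous_fst.prodMk continuous_const)
  have hnear : ∀ᶠ t in 𝓝 t₀, ∀ q ∈ frontier U, G t p < G t q :=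
    hK.eventually_forall_of_forall_eventually fun q hq =>
      hGp.continuousAt.eventually_lt hG.continuousAt (hlt q hq)
  obtain ⟨t, ht, htlt⟩ := (h.and_eventually hnear).exists
  obtain ⟨q, hq, hle⟩ := ht hU hUc p hp
  exact (htlt q hq).not_ge hle

theorem SatisfiesMinPrinciple.exists_le_abs_dist_sub {X : Type*} [PseudoMetricSpace X]
    [ProperSpace X] {g : X → ℝ} (hg : SatisfiesMinPrinciple g) (c : X) {r : ℝ} (hr : 0 < r) :
    ∃ x ∈ Metric.closedBall c r, r / 2 ≤ |dist x c - g x| := by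
  obtain ⟨q, hq, hle⟩ := hg Metric.isOpen_ball Metric.isBounded_ball.isCompact_closure c
    (Metric.mem_ball_self hr)
  have hqr : dist q c = r := Metric.frontier_ball_subset_sphere hq
  by_contra! h
  have hq_near := (abs_lt.1 (h q hqr.le)).2
  have hc_near := (abs_lt.1 (h c (Metric.mem_closedBall_self hr.le))).1
  rw [hqr] at hq_near
  rw [dist_self] at hc_near
  linarith

variable {E : Type*} [NormedAddCommGroup E] [NormedSpace ℝ E]

theorem exists_nonneg_add_smul_mem_frontier {U : Set E} (hU : Bornology.IsBounded U) {p v : E}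
    (hp : p ∈ U) (hv : v ≠ 0) : ∃ t : ℝ, 0 ≤ t ∧ p + t • v ∈ frontier U := by
  -- Parametrizing the ray by `|t|` makes the preimage of `U` a subset of the connected space `ℝ`.
  let ray : ℝ → E := fun t => p + |t| • v
  have hray : Continuous ray := by fun_prop
  have hne : ray ⁻¹' U ≠ univ := by
    intro huniv
    obtain ⟨R, hR⟩ := hU.subset_closedBall p
    have hbound : ∀ t : ℝ, |t| * ‖v‖ ≤ R := fun t => by
      simpa [ray, norm_smul] using hR (huniv ▸ mem_univ t : t ∈ ray ⁻¹' U)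
    obtain ⟨t, ht⟩ := exists_gt (R / ‖v‖)
    have hlarge : R < |t| * ‖v‖ :=
      (div_lt_iff₀ (norm_pos_iff.2 hv)).1 (ht.trans_le (le_abs_self t))
    exact hlarge.not_ge (hbound t)
  have hnonempty : (ray ⁻¹' U).Nonempty := ⟨0, by simpa [ray] using hp⟩
  obtain ⟨t, ht⟩ := nonempty_frontier_iff.2 ⟨hnonempty, hne⟩
  exact ⟨|t|, abs_nonneg t, hray.frontier_preimage_subset U ht⟩

theorem satisfiesMinPrinciple_of_forall_exists_ray {α : Type*} [LE α] {g : E → α}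
    (h : ∀ p, ∃ v ≠ 0, ∀ t : ℝ, 0 ≤ t → g (p + t • v) ≤ g p) : SatisfiesMinPrinciple g := by
  intro U _ hUc p hp
  obtain ⟨v, hv, hle⟩ := h p
  obtain ⟨t, ht, hq⟩ :=
    exists_nonneg_add_smul_mem_frontier (hUc.isBounded.subset subset_closure) hp hv
  exact ⟨p + t • v, hq, hle t ht⟩

theorem satisfiesMinPrinciple_linear_add_const [Nontrivial E] (ℓ : E →ₗ[ℝ] ℝ) (c : ℝ) :
    SatisfiesMinPrinciple fun x => ℓ x + c := by
  obtain ⟨v, hv, hℓv⟩ : ∃ v ≠ 0, ℓ v ≤ 0 := by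
    obtain ⟨v, hv⟩ := exists_ne (0 : E)
    rcases le_total (ℓ v) 0 with h | h
    · exact ⟨v, hv, h⟩
    · exact ⟨-v, neg_ne_zero.2 hv, by simpa using h⟩
  refine satisfiesMinPrinciple_of_forall_exists_ray fun p => ⟨v, hv, fun t ht => ?_⟩
  simpa using mul_nonpos_of_nonneg_of_nonpos ht hℓv

theorem satisfiesMinPrinciple_comp_of_not_injective {F α : Type*} [AddCommGroup F] [Module ℝ F]
    [Preorder α] {L : E →ₗ[ℝ] F} (hL : ¬ Injective L) (h : F → α) :
    SatisfiesMinPrinciple (h ∘ L) := by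
  obtain ⟨v, hLv, hv⟩ : ∃ v, L v = 0 ∧ v ≠ 0 := by
    simpa [injective_iff_map_eq_zero] using hL
  exact satisfiesMinPrinciple_of_forall_exists_ray fun p => ⟨v, hv, fun t _ => by simp [hLv]⟩

end MinPrinciple

theorem isOpenMap_of_continuous_of_injective {α β : Type*} [ConditionallyCompleteLinearOrder α]
    [TopologicalSpace α] [OrderTopology α] [DenselyOrdered α] [NoMinOrder α] [NoMaxOrder α]
    [LinearOrder β] [TopologicalSpace β] [OrderTopology β]
    {f : α → β} (hf : Continuous f) (hinj : Injective f) : IsOpenMap f := by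
  refine isOpenMap_iff_nhds_le.2 fun x s hs => ?_
  obtain ⟨l, u, -, hlu_nhds, hlu⟩ := exists_Icc_mem_subset_of_mem_nhds (mem_map.1 hs)
  obtain ⟨hlx, hxu⟩ := Icc_mem_nhds_iff.1 hlu_nhds
  have hsub : uIcc (f l) (f u) ⊆ s :=
    (intermediate_value_uIcc hf.continuousOn).trans
      (image_subset_iff.2 (uIcc_of_le (hlx.trans hxu).le ▸ hlu))
  refine mem_of_superset ?_ hsub
  rcases hf.strictMono_of_inj hinj with hmono | hanti
  · exact mem_of_superset (Icc_mem_nhds (hmono hlx) (hmono hxu)) Icc_subset_uIcc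
  · exact mem_of_superset (Icc_mem_nhds (hanti hxu) (hanti hlx)) Icc_subset_uIcc'

theorem frequently_injective_add_mul {σ : ℝ → ℝ} (hσ : Monotone σ ∨ Antitone σ) :
    ∃ᶠ δ in 𝓝 (0 : ℝ), Injective fun t => σ t + δ * t := by
  rcases hσ with hmono | hanti
  · exact (frequently_gt_nhds 0).mono fun δ hδ =>
      (hmono.add_strictMono (strictMono_mul_left_of_pos hδ)).injective
  · exact (frequently_lt_nhds 0).mono fun δ hδ =>
      (hanti.add_strictAnti (strictAnti_mul_left hδ)).injective

namespace NeuralNet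

@[fun_prop]
theorem continuous_affine {m n : ℕ} (W : Matrix (Fin n) (Fin m) ℝ) (b : Fin n → ℝ) :
    Continuous (affine W b) := by
  unfold affine
  fun_prop

theorem isOpenMap_affine {m n : ℕ} {W : Matrix (Fin n) (Fin m) ℝ}
    (hW : Surjective (Matrix.toLpLin 2 2 W)) (b : Fin n → ℝ) : IsOpenMap (affine W b) :=
  (isOpenMap_add_right (WithLp.toLp 2 b)).comp
    (LinearMap.isOpenMap_of_finiteDimensional (Matrix.toLpLin 2 2 W) hW)

@[fun_prop]
theorem continuous_applyCoord {σ : ℝ → ℝ} (hσ : Continuous σ) (n : ℕ) :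
    Continuous (applyCoord σ (n := n)) := by
  unfold applyCoord
  fun_prop

theorem isOpenMap_applyCoord {σ : ℝ → ℝ} (hσ : IsOpenMap σ) (n : ℕ) :
    IsOpenMap (applyCoord σ (n := n)) :=
  (PiLp.homeomorph 2 fun _ : Fin n => ℝ).symm.isOpenMap.comp
    ((IsOpenMap.piMap (fun _ => hσ) (by simp)).comp
      (PiLp.homeomorph 2 fun _ : Fin n => ℝ).isOpenMap)

theorem continuous_eval_of_continuous_uncurry {T : Type*} [TopologicalSpace T] {σ : T → ℝ → ℝ}
    (hσ : Continuous (uncurry σ)) {m n : ℕ} (N : NeuralNet m n) :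
    Continuous fun z : T × EuclideanSpace ℝ (Fin m) => N.eval (σ z.1) z.2 := by
  induction N with
  | output W b => exact (continuous_affine W b).comp continuous_snd
  | @hidden m k n W b N ih =>
    have hlayer : Continuous fun z : T × EuclideanSpace ℝ (Fin m) =>
        applyCoord (σ z.1) (affine W b z.2) := by
      unfold applyCoord
      fun_prop
    exact ih.comp (continuous_fst.prodMk hlayer)

theorem satisfiesMinPrinciple_eval_of_isOpenMap {σ : ℝ → ℝ} (hσ : Continuous σ)
    (hσo : IsOpenMap σ) {m n : ℕ} (N : NeuralNet m n) (hN : N.width ≤ m) (i : Fin n) :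
    SatisfiesMinPrinciple fun x => N.eval σ x i := by
  induction N with
  | @output m n W b =>
    have : NeZero m := ⟨(i.pos.trans_le hN).ne'⟩
    exact satisfiesMinPrinciple_linear_add_const
      ((EuclideanSpace.proj i).toLinearMap ∘ₗ Matrix.toLpLin 2 2 W) (b i)
  | @hidden m k n W b N ih =>
    obtain ⟨hkm, hNm⟩ : k ≤ m ∧ N.width ≤ m := max_le_iff.1 hN
    by_cases hW : Injective (Matrix.toLpLin 2 2 W)
    · have hmk : m ≤ k := by simpa using LinearMap.finrank_le_finrank_of_injective hW
      have hWsurj : Surjective (Matrix.toLpLin 2 2 W) :=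
        (LinearMap.injective_iff_surjective_of_finrank_eq_finrank
          (by simpa using hmk.antisymm hkm)).1 hW
      exact (ih (hNm.trans hmk) i).comp
        ((continuous_applyCoord hσ k).comp (continuous_affine W b))
        ((isOpenMap_applyCoord hσo k).comp (isOpenMap_affine hWsurj b))
    · exact satisfiesMinPrinciple_comp_of_not_injective hW
        fun y => N.eval σ (applyCoord σ (y + WithLp.toLp 2 b)) i

theorem satisfiesMinPrinciple_eval {σ : ℝ → ℝ} (hσ : Continuous σ)
    (hmono : Monotone σ ∨ Antitone σ) {m n : ℕ} (N : NeuralNet m n) (hN : N.width ≤ m)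
    (i : Fin n) : SatisfiesMinPrinciple fun x => N.eval σ x i := by
  let τ : ℝ → ℝ → ℝ := fun δ t => σ t + δ * t
  have hτ : Continuous (uncurry τ) := by fun_prop
  have hτ_zero : τ 0 = σ := by simp [τ]
  have hG : Continuous (uncurry fun δ x => N.eval (τ δ) x i) :=
    (PiLp.continuous_apply 2 _ i).comp (continuous_eval_of_continuous_uncurry hτ N)
  rw [← hτ_zero]
  refine SatisfiesMinPrinciple.of_frequently hG
    ((frequently_injective_add_mul hmono).mono fun δ hδ => ?_)
  have hτδ : Continuous (τ δ) := by fun_prop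
  exact satisfiesMinPrinciple_eval_of_isOpenMap hτδ
    (isOpenMap_of_continuous_of_injective hτδ hδ) N hN i

end NeuralNet

theorem closedBall_center_subset_cube (a b : ℝ) (d : ℕ) :
    Metric.closedBall (WithLp.toLp 2 fun _ => (a + b) / 2) ((b - a) / 2) ⊆ cube a b d := by
  intro x hx i
  rw [Real.Icc_eq_closedBall, mem_closedBall_iff_norm]
  exact (PiLp.norm_apply_le (x - WithLp.toLp 2 fun _ => (a + b) / 2) i).trans
    (mem_closedBall_iff_norm.1 hx)

theorem norm_lt_of_supNormOn_lt {m n : ℕ} {D : Set (EuclideanSpace ℝ (Fin m))}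
    {g : EuclideanSpace ℝ (Fin m) → EuclideanSpace ℝ (Fin n)} {ε : ℝ}
    (h : supNormOn D g < ENNReal.ofReal ε) {x : EuclideanSpace ℝ (Fin m)} (hx : x ∈ D) :
    ‖g x‖ < ε := by
  have hgx : ‖g x‖ₑ < ENNReal.ofReal ε :=
    (le_iSup₂ (f := fun x (_ : x ∈ D) => ‖g x‖ₑ) x hx).trans_lt h
  rwa [← ofReal_norm, ENNReal.ofReal_lt_ofReal_iff_of_nonneg (norm_nonneg _)] at hgx

theorem IsUniversalWidth.exists_abs_sub_eval_lt {σ : ℝ → ℝ} {a b : ℝ} {dIn dOut w : ℕ}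
    (hw : IsUniversalWidth σ a b dIn dOut w) {φ : EuclideanSpace ℝ (Fin dIn) → ℝ}
    (hφ : ContinuousOn φ (cube a b dIn)) {ε : ℝ} (hε : 0 < ε) (i : Fin dOut) :
    ∃ N : NeuralNet dIn dOut, N.width ≤ w ∧ ∀ x ∈ cube a b dIn, |φ x - N.eval σ x i| < ε := by
  obtain ⟨N, hNw, hN⟩ := hw (fun x => WithLp.toLp 2 fun _ => φ x) (by fun_prop) ε hε
  exact ⟨N, hNw, fun x hx =>
    (PiLp.norm_apply_le _ i).trans_lt (norm_lt_of_supNormOn_lt hN hx)⟩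

theorem IsUniversalWidth.dIn_lt {σ : ℝ → ℝ} (hσ : Continuous σ) (hmono : Monotone σ ∨ Antitone σ)
    {a b : ℝ} (hab : a < b) {dIn dOut w : ℕ} (hOut : 1 ≤ dOut)
    (hw : IsUniversalWidth σ a b dIn dOut w) : dIn < w := by
  by_contra! hle
  let c : EuclideanSpace ℝ (Fin dIn) := WithLp.toLp 2 fun _ => (a + b) / 2
  have hr : 0 < (b - a) / 2 := half_pos (sub_pos.2 hab)
  obtain ⟨N, hNw, hN⟩ := hw.exists_abs_sub_eval_lt (φ := fun x => dist x c) (by fun_prop)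
    (half_pos hr) ⟨0, hOut⟩
  have hmin := N.satisfiesMinPrinciple_eval hσ hmono (hNw.trans hle) ⟨0, hOut⟩
  obtain ⟨x, hx, hfar⟩ := hmin.exists_le_abs_dist_sub c hr
  exact hfar.not_gt (hN x (closedBall_center_subset_cube a b dIn hx))

theorem lt_minWidth {σ : ℝ → ℝ} {a b : ℝ} {dIn dOut d : ℕ}
    (h : ∀ w, IsUniversalWidth σ a b dIn dOut w → d < w) : (d : ℕ∞) < minWidth σ a b dIn dOut := by
  refine ENat.natCast_add_one_le_iff.1 (le_sInf ?_)
  rintro _ ⟨w, rfl, hw⟩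
  exact_mod_cast Nat.succ_le_of_lt (h w hw)

theorem continuous_relu : Continuous relu := continuous_id.max continuous_const

theorem monotone_relu : Monotone relu := monotone_id.max monotone_const

theorem mainTheorem2_general {σ : ℝ → ℝ} (hσ : Continuous σ) (hmono : Monotone σ ∨ Antitone σ)
    {a b : ℝ} (hab : a < b) {dIn dOut : ℕ} (hOut : 1 ≤ dOut) :
    (dIn : ℕ∞) < minWidth σ a b dIn dOut :=
  lt_minWidth fun _ hw => hw.dIn_lt hσ hmono hab hOut

theorem mainTheorem2 (σ : ℝ → ℝ)
    (hσ : (Continuous σ ∧ (StrictMono σ ∨ StrictAnti σ)) ∨ σ = relu)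
    (a b : ℝ) (hab : a < b) (dIn dOut : ℕ) (hOut : 1 ≤ dOut) :
    (dIn : ℕ∞) < minWidth σ a b dIn dOut := by
  rcases hσ with ⟨hcont, hmono⟩ | rfl
  · exact mainTheorem2_general hcont (hmono.imp StrictMono.monotone StrictAnti.antitone) hab hOut
  · exact mainTheorem2_general continuous_relu (.inl monotone_relu) hab hOut
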